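/- Let $G$ be a group, written multiplicatively with identity element $e$, that is torsion-free (no element other than $e$ has finite order) and hypercentral (every non-trivial factor group of $G$ has a non-trivial center). Let $R$ be a unital, not necessarily associative ring which is $G$-graded, i.e. there are additive subgroups $R_g$ of $R$ ($g\in G$) such that $R=\bigoplus_{g\in G}R_g$ and $R_gR_h\subseteq R_{gh}$ for all $g,h\in G$. Put $\operatorname{supp}(R)=\{g\in G : R_g\neq\{0\}\}$. Assume that $\operatorname{supp}(R)=G$ and that the grading is faithful: for all $g,h\in\operatorname{supp}(R)$ and all non-zero $r\in R_g$ we have $rR_h\neq\{0\}\neq R_hr$. Let $Z(R)$ be the center of $R$, i.e. the set of elements of $R$ that commute with every element of $R$ and associate with all pairs of elements of $R$ (in each of the three positions). Call a two-sided ideal $I$ of $R$ graded if $I=\bigoplus_{g\in G}(I\cap R_g)$, and call $R$ graded simple if its only graded two-sided ideals are $\{0\}$ and $R$. Then $R$ is simple (its only two-sided ideals are $\{0\}$ and $R$, and $R\neq\{0\}$) if and only if $R$ is graded simple and $Z(R)\subseteq R_e$. -/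

import Mathlib

/-- `G` is hypercentral: every non-trivial factor group of `G` has non-trivial center. -/
def IsHypercentral (G : Type*) [Group G] : Prop :=
  ∀ (N : Subgroup G) [N.Normal], Nontrivial (G ⧸ N) → Nontrivial (Subgroup.center (G ⧸ N))

/-- `G` is torsion-free: only the identity element has finite order. -/
def IsTorsionFreeGroup (G : Type*) [Group G] : Prop :=
  ∀ g : G, g ≠ 1 → ¬ IsOfFinOrder g

/-- The additive subgroups `A g` make the (not necessarily associative) unital ring `R` into a
`G`-graded ring: `R` is their internal direct sum and `A g * A h ⊆ A (g * h)`. -/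
structure IsGroupGrading {G R : Type*} [Group G] [DecidableEq G] [NonAssocRing R]
    (A : G → AddSubgroup R) : Prop where
  isInternal : DirectSum.IsInternal A
  mul_mem : ∀ {g h : G} {x y : R}, x ∈ A g → y ∈ A h → x * y ∈ A (g * h)

/-- The support of a graded ring: the degrees whose homogeneous component is non-zero. -/
def gradingSupport {G R : Type*} [NonAssocRing R] (A : G → AddSubgroup R) : Set G :=
  {g | A g ≠ ⊥}

/-- The grading is faithful: for degrees `g`, `h` in the support and `0 ≠ r ∈ A g`, neither
`r * A h` nor `A h * r` is zero. -/
def IsFaithfulGrading {G R : Type*} [NonAssocRing R] (A : G → AddSubgroup R) : Prop :=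
  ∀ g ∈ gradingSupport A, ∀ h ∈ gradingSupport A, ∀ r ∈ A g, r ≠ 0 →
    (∃ s ∈ A h, r * s ≠ 0) ∧ (∃ s ∈ A h, s * r ≠ 0)

/-- The two-sided ideal `I` is graded: `I` is the sum of the subgroups `I ∩ A g`.  (For a
grading `A` this sum is automatically direct.) -/
def IsGradedIdeal {G R : Type*} [NonAssocRing R] (A : G → AddSubgroup R)
    (I : TwoSidedIdeal R) : Prop :=
  AddSubgroup.ofClass I = ⨆ g, AddSubgroup.ofClass I ⊓ A g

/-- `R` is graded simple: its only graded two-sided ideals are `0` and `R`. -/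
def IsGradedSimple {G R : Type*} [NonAssocRing R] (A : G → AddSubgroup R) : Prop :=
  ∀ I : TwoSidedIdeal R, IsGradedIdeal A I → I = ⊥ ∨ I = ⊤

/-! Suppose `R` is simple and `z` is central. Faithfulness makes the support of `z`
conjugation-invariant, so its degrees have finite conjugacy classes and are central in `G`
(`mem_center_of_finite_range_conj`). Components of `z` in central degrees are again central. A
non-zero central `c` of degree `g ≠ 1` cannot exist: `1 + c` would be invertible, but `g` has
infinite order and the inverse would have infinite support.

Conversely, induct along the hypercentral structure on the claim: an ideal `I` with a non-zero
element supported in one coset of `N` is all of `R`. The trivial subgroup is graded simplicity;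
chains use finiteness of supports. To pass from `N` to the preimage of the center of `G ⧸ N`, take
an element of `I` meeting fewest cosets of `N`. The claim for `N`, applied to `leadingIdeal`,
replaces it by some `y ∈ I` whose part on `N` is `1`. Commutators and associators of `y` equal those
of `y - 1`, which meets fewer cosets, so they vanish. Thus `y` is central, hence in `A 1`, and
graded simplicity gives `I = ⊤`. -/

section Hypercentral

/-! ### Finite conjugacy classes in torsion-free hypercentral groups -/

variable {G : Type*} [Group G]

/-- Zorn gives a maximal normal `N` satisfying `P`; if `N ≠ ⊤`, the preimage of the non-trivial
center of `G ⧸ N` would be strictly larger. -/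
theorem IsHypercentral.induction (hG : IsHypercentral G) {P : Subgroup G → Prop} (bot : P ⊥)
    (chain : ∀ c : Set (Subgroup G), c.Nonempty → IsChain (· ≤ ·) c → (∀ N ∈ c, P N) → P (sSup c))
    (step : ∀ (N : Subgroup G) [N.Normal], P N →
      P ((Subgroup.center (G ⧸ N)).comap (QuotientGroup.mk' N))) : P ⊤ := by
  have hsup : ∀ c : Set (Subgroup G), c.Nonempty → IsChain (· ≤ ·) c → (∀ N ∈ c, N.Normal) →
      (sSup c).Normal := by
    intro c hne hchain hc
    refine ⟨fun n hn g => ?_⟩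
    rw [Subgroup.mem_sSup_of_directedOn hne hchain.directedOn] at hn ⊢
    obtain ⟨s, hs, hns⟩ := hn
    exact ⟨s, hs, (hc s hs).conj_mem n hns g⟩
  obtain ⟨N, -, ⟨hN, hPN⟩, hmax⟩ := zorn_le_nonempty₀ {N : Subgroup G | N.Normal ∧ P N}
    (fun c hc hchain y hy => ⟨sSup c, ⟨hsup c ⟨y, hy⟩ hchain fun N hN => (hc hN).1,
      chain c ⟨y, hy⟩ hchain fun N hN => (hc hN).2⟩, fun z hz => le_sSup hz⟩) ⊥
    ⟨inferInstance, bot⟩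
  by_cases hT : N = ⊤
  · exact hT ▸ hPN
  have hnt : Nontrivial (G ⧸ N) := by
    rw [← not_subsingleton_iff_nontrivial, QuotientGroup.subsingleton_iff]
    exact hT
  obtain ⟨⟨z, hz⟩, hz1⟩ := @exists_ne _ (hG N hnt) 1
  obtain ⟨m, rfl⟩ := QuotientGroup.mk'_surjective N z
  refine absurd ?_ hz1
  have hle : N ≤ (Subgroup.center (G ⧸ N)).comap (QuotientGroup.mk' N) := fun x hx => by
    rw [Subgroup.mem_comap, QuotientGroup.mk'_apply, (QuotientGroup.eq_one_iff x).2 hx]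
    exact one_mem _
  exact Subtype.ext ((QuotientGroup.eq_one_iff m).2
    (hmax ⟨inferInstance, step N hPN⟩ hle (show QuotientGroup.mk' N m ∈ _ from hz)))

/-- The conjugacy class of `g * (h * g⁻¹ * h⁻¹)` is finite whenever that of `g` is. -/
theorem finite_range_conj_commutator {g : G} (hg : (Set.range fun a : G => a * g * a⁻¹).Finite)
    (h : G) : (Set.range fun a : G => a * (g * (h * g⁻¹ * h⁻¹)) * a⁻¹).Finite := by
  -- The commutator is `g` times the inverse of a conjugate of `g`.
  refine (Set.Finite.image2 (fun x y => x * y⁻¹) hg hg).subset ?_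
  rintro _ ⟨a, rfl⟩
  exact ⟨_, ⟨a, rfl⟩, _, ⟨a * h, rfl⟩, by simp; group⟩

/-- Pigeonhole: two different powers of `h` conjugate `g` to the same element. -/
theorem exists_pow_commute_of_finite_range_conj {g : G}
    (hg : (Set.range fun a : G => a * g * a⁻¹).Finite) (h : G) :
    ∃ n : ℕ, 0 < n ∧ Commute (h ^ n) g := by
  have : Finite (Set.range fun a : G => a * g * a⁻¹) := hg
  obtain ⟨i, j, hij, he⟩ := Finite.exists_ne_map_eq_of_infinite
    (fun n : ℕ => (⟨h ^ n * g * (h ^ n)⁻¹, h ^ n, rfl⟩ : Set.range fun a : G => a * g * a⁻¹))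
  have key : ∀ i j : ℕ, i < j → h ^ i * g * (h ^ i)⁻¹ = h ^ j * g * (h ^ j)⁻¹ →
      ∃ n : ℕ, 0 < n ∧ Commute (h ^ n) g := by
    intro i j hlt he
    refine ⟨j - i, by omega, ?_⟩
    obtain ⟨k, rfl⟩ := Nat.exists_eq_add_of_lt hlt
    have hk : i + k + 1 - i = k + 1 := by omega
    rw [hk]
    rw [add_assoc, pow_add] at he
    have : g = h ^ (k + 1) * g * (h ^ (k + 1))⁻¹ := by
      apply mul_left_cancel (a := h ^ i)
      apply mul_right_cancel (b := (h ^ i)⁻¹)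
      rw [he]; group
    exact (eq_mul_inv_iff_mul_eq.1 this).symm
  have he' := congrArg Subtype.val he
  rcases lt_or_gt_of_ne hij with hlt | hlt
  · exact key i j hlt he'
  · exact key j i hlt he'.symm

/-- With `z` the central commutator, `g * h ^ n = z ^ n * h ^ n * g`, so `z ^ n = 1` and
torsion-freeness gives `z = 1`. -/
theorem commute_of_pow_commute_of_commutator_mem_center (htf : IsTorsionFreeGroup G) {g h : G}
    {n : ℕ} (hn : 0 < n) (hc : Commute (h ^ n) g)
    (hz : g * (h * g⁻¹ * h⁻¹) ∈ Subgroup.center G) : Commute g h := by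
  set z := g * (h * g⁻¹ * h⁻¹) with hzdef
  have hgh : SemiconjBy g h (z * h) := by
    rw [SemiconjBy, hzdef]; group
  have hpow := hgh.pow_right n
  have hzh : Commute z h := (Subgroup.mem_center_iff.1 hz h).symm
  rw [hzh.mul_pow] at hpow
  have h1 : z ^ n = 1 := by
    have := hpow.eq
    rw [← hc.eq, mul_assoc] at this
    exact mul_eq_right.1 this.symm
  have hz1 : z = 1 := by
    by_contra hne
    exact htf z hne (isOfFinOrder_iff_pow_eq_one.2 ⟨n, hn, h1⟩)
  rw [hz1, one_mul] at hgh
  exact hgh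

theorem mem_center_of_finite_range_conj (htf : IsTorsionFreeGroup G) (hG : IsHypercentral G)
    {g : G} (hg : (Set.range fun a : G => a * g * a⁻¹).Finite) : g ∈ Subgroup.center G := by
  have key : ∀ g ∈ (⊤ : Subgroup G), (Set.range fun a : G => a * g * a⁻¹).Finite →
      g ∈ Subgroup.center G := by
    refine hG.induction (P := fun N => ∀ g ∈ N, (Set.range fun a : G => a * g * a⁻¹).Finite →
      g ∈ Subgroup.center G) ?_ ?_ ?_
    · intro g hg _
      rw [Subgroup.mem_bot.1 hg]
      exact one_mem _
    · intro c hne hchain ih g hg hfin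
      obtain ⟨s, hs, hgs⟩ := (Subgroup.mem_sSup_of_directedOn hne hchain.directedOn).1 hg
      exact ih s hs g hgs hfin
    · intro N _ ih g hg hfin
      rw [Subgroup.mem_center_iff]
      intro h
      obtain ⟨n, hn, hcomm⟩ := exists_pow_commute_of_finite_range_conj hfin h
      refine (commute_of_pow_commute_of_commutator_mem_center htf hn hcomm
        (ih _ ?_ (finite_range_conj_commutator hfin h))).eq.symm
      have hg' := Subgroup.mem_center_iff.1 (Subgroup.mem_comap.1 hg) (QuotientGroup.mk' N h)
      rw [← QuotientGroup.eq_one_iff, ← QuotientGroup.mk'_apply]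
      simp only [map_mul, map_inv]
      rw [← mul_assoc, ← mul_assoc, ← hg']
      group
  exact key g (Subgroup.mem_top g) hg

end Hypercentral
-- Homogeneous components and graded ideals
namespace IsGroupGrading

variable {G R : Type*} [Group G] [DecidableEq G] [NonAssocRing R] {A : G → AddSubgroup R}

/-- The projection of a graded ring onto its homogeneous component of degree `g`. -/
noncomputable def component (hA : IsGroupGrading A) (g : G) : R →+ R :=
  letI := hA.isInternal.chooseDecomposition
  (A g).subtype.comp <| (DFinsupp.evalAddMonoidHom g).comp
    (DirectSum.decomposeAddEquiv A).toAddMonoidHom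

variable (hA : IsGroupGrading A)
include hA

theorem component_mem (g : G) (x : R) : hA.component g x ∈ A g :=
  SetLike.coe_mem _

theorem component_of_mem {g h : G} {x : R} (hx : x ∈ A h) :
    hA.component g x = if g = h then x else 0 := by
  let := hA.isInternal.chooseDecomposition
  split_ifs with hgh
  · subst hgh
    exact DirectSum.decompose_of_mem_same A hx
  · exact DirectSum.decompose_of_mem_ne A hx (Ne.symm hgh)

theorem ext_component {x y : R} (h : ∀ g, hA.component g x = hA.component g y) : x = y := by
  let := hA.isInternal.chooseDecomposition
  apply (DirectSum.decompose A).injective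
  exact DFinsupp.ext fun g => Subtype.ext (h g)

theorem exists_component_ne_zero {x : R} (hx : x ≠ 0) : ∃ g, hA.component g x ≠ 0 := by
  by_contra! h
  exact hx (hA.ext_component fun g => by rw [h g, map_zero])

theorem finite_setOf_component_ne_zero (x : R) : {g | hA.component g x ≠ 0}.Finite := by
  classical
  let := hA.isInternal.chooseDecomposition
  refine (DFinsupp.support (DirectSum.decompose A x)).finite_toSet.subset fun g hg => ?_
  rw [Finset.mem_coe, DFinsupp.mem_support_toFun]
  exact fun h => hg (congrArg Subtype.val h)

theorem homogeneous_induction {motive : R → Prop} (mem : ∀ g, ∀ x ∈ A g, motive x)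
    (add : ∀ x y, motive x → motive y → motive (x + y)) (x : R) : motive x := by
  let := hA.isInternal.chooseDecomposition
  exact DirectSum.Decomposition.inductionOn A (mem 1 0 (zero_mem _))
    (fun m => mem _ _ m.2) add x

theorem component_mul_right {k : G} {t : R} (ht : t ∈ A k) (g : G) (x : R) :
    hA.component g (x * t) = hA.component (g * k⁻¹) x * t := by
  induction x using hA.homogeneous_induction with
  | mem h x hx =>
    rw [hA.component_of_mem (hA.mul_mem hx ht), hA.component_of_mem hx, ite_mul, zero_mul]
    simp only [mul_inv_eq_iff_eq_mul]
  | add x y hx hy => simp only [add_mul, map_add, hx, hy]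

theorem component_mul_left {k : G} {t : R} (ht : t ∈ A k) (g : G) (x : R) :
    hA.component g (t * x) = t * hA.component (k⁻¹ * g) x := by
  induction x using hA.homogeneous_induction with
  | mem h x hx =>
    rw [hA.component_of_mem (hA.mul_mem ht hx), hA.component_of_mem hx, mul_ite, mul_zero]
    simp only [inv_mul_eq_iff_eq_mul]
  | add x y hx hy => simp only [mul_add, map_add, hx, hy]

/-- Comparing degrees in `x * 1 = x` shows that the degree-`1` component of `1` is a right identity.
-/
theorem one_mem : (1 : R) ∈ A 1 := by
  have key : ∀ x : R, x * hA.component 1 1 = x := by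
    intro x
    induction x using hA.homogeneous_induction with
    | mem h x hx =>
      have := hA.component_mul_left hx h 1
      rw [mul_one, inv_mul_cancel, hA.component_of_mem hx, if_pos rfl] at this
      exact this.symm
    | add x y hx hy => rw [add_mul, hx, hy]
  have := key 1
  rw [one_mul] at this
  exact this ▸ hA.component_mem 1 1

theorem exists_component_eq_ite (p : G → Prop) [DecidablePred p] (x : R) :
    ∃ y, ∀ g, hA.component g y = if p g then hA.component g x else 0 := by
  induction x using hA.homogeneous_induction with
  | mem h x hx =>
    by_cases hp : p h
    · refine ⟨x, fun g => ?_⟩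
      rw [hA.component_of_mem hx]
      split_ifs <;> simp_all
    · refine ⟨0, fun g => ?_⟩
      rw [hA.component_of_mem hx, map_zero]
      split_ifs <;> simp_all
  | add x y hx hy =>
    obtain ⟨x', hx'⟩ := hx
    obtain ⟨y', hy'⟩ := hy
    refine ⟨x' + y', fun g => ?_⟩
    rw [map_add, map_add, hx', hy']
    split_ifs <;> simp

theorem isGradedIdeal_of_component_mem {I : TwoSidedIdeal R}
    (hI : ∀ x ∈ I, ∀ g, hA.component g x ∈ I) : IsGradedIdeal A I := by
  let := hA.isInternal.chooseDecomposition
  classical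
  refine le_antisymm (fun x hx => ?_) (iSup_le fun g => inf_le_left)
  rw [← DirectSum.sum_support_decompose A x]
  refine sum_mem fun g _ => AddSubgroup.mem_iSup_of_mem g ⟨hI x hx g, SetLike.coe_mem _⟩

/-- In a graded simple ring, an ideal containing a non-zero homogeneous element is everything. -/
theorem eq_top_of_homogeneous_mem (hs : IsGradedSimple A) {I : TwoSidedIdeal R} {g : G} {x : R}
    (hxI : x ∈ I) (hx : x ∈ A g) (hx0 : x ≠ 0) : I = ⊤ := by
  -- The largest graded ideal inside `I`.
  let J : TwoSidedIdeal R := TwoSidedIdeal.mk' {r | ∀ g, hA.component g r ∈ I}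
    (fun g => by rw [map_zero]; exact I.zero_mem)
    (fun hx hy g => by rw [map_add]; exact I.add_mem (hx g) (hy g))
    (fun hx g => by rw [map_neg]; exact I.neg_mem (hx g))
    (fun {t r} hr => by
      induction t using hA.homogeneous_induction with
      | mem k t ht =>
        intro g
        rw [hA.component_mul_left ht]
        exact I.mul_mem_left _ _ (hr _)
      | add t s h1 h2 =>
        intro g
        rw [add_mul, map_add]
        exact I.add_mem (h1 g) (h2 g))
    (fun {r t} hr => by
      induction t using hA.homogeneous_induction with
      | mem k t ht =>
        intro g
        rw [hA.component_mul_right ht]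
        exact I.mul_mem_right _ _ (hr _)
      | add t s h1 h2 =>
        intro g
        rw [mul_add, map_add]
        exact I.add_mem (h1 g) (h2 g))
  have hJ : ∀ r, r ∈ J ↔ ∀ g, hA.component g r ∈ I := fun r => TwoSidedIdeal.mem_mk' _ _ _ _ _ _ r
  have hJg : IsGradedIdeal A J := hA.isGradedIdeal_of_component_mem fun r hr g => by
    rw [hJ] at hr ⊢
    intro h
    rw [hA.component_of_mem (hA.component_mem g r)]
    split_ifs
    · exact hr g
    · exact I.zero_mem
  rcases hs J hJg with h | h
  · refine absurd ((TwoSidedIdeal.mem_bot R).1 (h ▸ (hJ x).2 fun k => ?_)) hx0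
    rw [hA.component_of_mem hx]
    split_ifs
    · exact hxI
    · exact I.zero_mem
  · have h1 : (1 : R) ∈ J := h ▸ trivial
    have := (hJ 1).1 h1 1
    rw [hA.component_of_mem hA.one_mem, if_pos rfl] at this
    exact (TwoSidedIdeal.one_mem_iff I).1 this

end IsGroupGrading
-- Ideals of a graded simple ring whose center lies in degree `1`
namespace IsGroupGrading

variable {G R Q : Type*} [Group G] [DecidableEq G] [NonAssocRing R] [Group Q]
  {A : G → AddSubgroup R} (hA : IsGroupGrading A)

/-- The elements whose homogeneous components lie in degrees `g` with `f g ∈ q • T`. -/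
def supportedIn (f : G →* Q) (T : Set Q) (q : Q) : AddSubgroup R where
  carrier := {x | ∀ g, q⁻¹ * f g ∉ T → hA.component g x = 0}
  zero_mem' := fun _ _ => map_zero _
  add_mem' := fun hx hy g hg => by rw [map_add, hx g hg, hy g hg, add_zero]
  neg_mem' := fun hx g hg => by rw [map_neg, hx g hg, neg_zero]

variable {f : G →* Q} {T : Set Q} {q : Q}

theorem mem_supportedIn {x : R} :
    x ∈ hA.supportedIn f T q ↔ ∀ g, q⁻¹ * f g ∉ T → hA.component g x = 0 :=
  Iff.rfl

theorem mul_mem_supportedIn_left {x t : R} {k : G} (hx : x ∈ hA.supportedIn f T q)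
    (ht : t ∈ A k) : t * x ∈ hA.supportedIn f T (f k * q) := by
  intro g hg
  rw [hA.component_mul_left ht, hx, mul_zero]
  rwa [map_mul, map_inv, ← mul_assoc, ← mul_inv_rev]

theorem mul_mem_supportedIn_right (hT : ∀ t ∈ T, ∀ c, c⁻¹ * t * c ∈ T) {x t : R} {k : G}
    (hx : x ∈ hA.supportedIn f T q) (ht : t ∈ A k) :
    x * t ∈ hA.supportedIn f T (q * f k) := by
  intro g hg
  rw [hA.component_mul_right ht, hx, zero_mul]
  intro h
  apply hg
  have := hT _ h (f k)
  rw [map_mul, map_inv] at this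
  convert this using 1
  group

/-- The ideal of elements that agree, on every coset `q`, with an element of `I` supported in
`q • T`. -/
def leadingIdeal (f : G →* Q) (T : Set Q) (hT : ∀ t ∈ T, ∀ c, c⁻¹ * t * c ∈ T)
    (I : TwoSidedIdeal R) : TwoSidedIdeal R :=
  have h1 : ∀ t ∈ ({1}ᶜ : Set Q), ∀ c, c⁻¹ * t * c ∈ ({1}ᶜ : Set Q) := by
    intro t ht c h
    apply ht
    have := congrArg (fun x => c * x * c⁻¹) (Set.mem_singleton_iff.1 h)
    simpa [mul_assoc] using this
  TwoSidedIdeal.mk'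
    -- Membership of `r - y` in the last subgroup says that it vanishes in all degrees over `q`.
    {r | ∀ q, ∃ y ∈ I, y ∈ hA.supportedIn f T q ∧ r - y ∈ hA.supportedIn f {1}ᶜ q}
    (fun q => ⟨0, I.zero_mem, zero_mem _, by rw [sub_zero]; exact zero_mem _⟩)
    (fun {r s} hr hs q => by
      obtain ⟨y, hyI, hy, hry⟩ := hr q
      obtain ⟨z, hzI, hz, hsz⟩ := hs q
      refine ⟨y + z, I.add_mem hyI hzI, add_mem hy hz, ?_⟩
      rw [add_sub_add_comm]
      exact add_mem hry hsz)
    (fun {r} hr q => by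
      obtain ⟨y, hyI, hy, hry⟩ := hr q
      refine ⟨-y, I.neg_mem hyI, neg_mem hy, ?_⟩
      rw [← neg_sub_neg, neg_neg, neg_neg, ← neg_sub]
      exact neg_mem hry)
    (fun {t r} hr => by
      induction t using hA.homogeneous_induction with
      | mem k t ht =>
        intro q
        obtain ⟨y, hyI, hy, hry⟩ := hr ((f k)⁻¹ * q)
        refine ⟨t * y, I.mul_mem_left _ _ hyI, ?_, ?_⟩
        · simpa using hA.mul_mem_supportedIn_left hy ht
        · simpa [mul_sub] using hA.mul_mem_supportedIn_left hry ht
      | add t s hr hs =>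
        intro q
        obtain ⟨y, hyI, hy, hry⟩ := hr q
        obtain ⟨z, hzI, hz, hsz⟩ := hs q
        refine ⟨y + z, I.add_mem hyI hzI, add_mem hy hz, ?_⟩
        rw [add_mul, add_sub_add_comm]
        exact add_mem hry hsz)
    (fun {r t} hr => by
      induction t using hA.homogeneous_induction with
      | mem k t ht =>
        intro q
        obtain ⟨y, hyI, hy, hry⟩ := hr (q * (f k)⁻¹)
        refine ⟨y * t, I.mul_mem_right _ _ hyI, ?_, ?_⟩
        · simpa using hA.mul_mem_supportedIn_right hT hy ht
        · simpa [sub_mul] using hA.mul_mem_supportedIn_right h1 hry ht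
      | add t s hr hs =>
        intro q
        obtain ⟨y, hyI, hy, hry⟩ := hr q
        obtain ⟨z, hzI, hz, hsz⟩ := hs q
        refine ⟨y + z, I.add_mem hyI hzI, add_mem hy hz, ?_⟩
        rw [mul_add, add_sub_add_comm]
        exact add_mem hry hsz)

theorem mem_leadingIdeal {hT : ∀ t ∈ T, ∀ c, c⁻¹ * t * c ∈ T} {I : TwoSidedIdeal R} {r : R} :
    r ∈ hA.leadingIdeal f T hT I ↔
      ∀ q, ∃ y ∈ I, y ∈ hA.supportedIn f T q ∧ r - y ∈ hA.supportedIn f {1}ᶜ q := by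
  rw [leadingIdeal, TwoSidedIdeal.mem_mk', Set.mem_ofPred_eq]

include hA in
/-- An element that commutes and associates with the homogeneous elements is central. -/
theorem mem_center_of_homogeneous {z : R} (comm : ∀ g, ∀ r ∈ A g, z * r = r * z)
    (left : ∀ g h, ∀ r ∈ A g, ∀ s ∈ A h, z * (r * s) = z * r * s)
    (right : ∀ g h, ∀ r ∈ A g, ∀ s ∈ A h, r * s * z = r * (s * z)) : z ∈ Set.center R := by
  refine ⟨fun r => ?_, fun r s => ?_, fun r s => ?_⟩
  · rw [commute_iff_eq]
    induction r using hA.homogeneous_induction with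
    | mem g r hr => exact comm g r hr
    | add a b ha hb => rw [mul_add, add_mul, ha, hb]
  · induction r using hA.homogeneous_induction with
    | mem g r hr =>
      induction s using hA.homogeneous_induction with
      | mem h s hs => exact left g h r hr s hs
      | add a b ha hb => simp only [mul_add, ha, hb]
    | add a b ha hb => simp only [mul_add, add_mul, ha, hb]
  · induction r using hA.homogeneous_induction with
    | mem g r hr =>
      induction s using hA.homogeneous_induction with
      | mem h s hs => exact right g h r hr s hs
      | add a b ha hb => simp only [mul_add, add_mul, ha, hb]
    | add a b ha hb => simp only [add_mul, ha, hb]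

/-- If every ideal containing a non-zero element supported in one coset is everything, then the
same holds for ideals containing a non-zero element supported in one coset of the centre. -/
theorem eq_top_of_supportedIn_center (hs : IsGradedSimple A)
    (hc : Set.center R ⊆ (A 1 : Set R))
    (hf : ∀ (I : TwoSidedIdeal R) (q : Q), ∀ x ∈ I, x ≠ 0 → x ∈ hA.supportedIn f {1} q → I = ⊤)
    (I : TwoSidedIdeal R) {x : R} (hxI : x ∈ I) (hx0 : x ≠ 0)
    (hx : x ∈ hA.supportedIn f (Subgroup.center Q : Set Q) q) : I = ⊤ := by
  classical
  -- Minimize the number of cosets over all non-zero elements of `I` supported in some translate of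
  -- the center.
  have hex : ∃ n, ∃ T : Finset Q, T.card = n ∧ (∀ t ∈ T, t ∈ Subgroup.center Q) ∧
      ∃ q, ∃ x ∈ I, x ≠ 0 ∧ x ∈ hA.supportedIn f (T : Set Q) q := by
    refine ⟨_, (hA.finite_setOf_component_ne_zero x).toFinset.image (fun g => q⁻¹ * f g), rfl,
      ?_, q, x, hxI, hx0, ?_⟩
    · intro t ht
      obtain ⟨g, hg, rfl⟩ := Finset.mem_image.1 ht
      by_contra h
      exact (Set.Finite.mem_toFinset _).1 hg (hx g h)
    · intro g hg
      by_contra h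
      exact hg (Finset.mem_coe.2 (Finset.mem_image_of_mem _ ((Set.Finite.mem_toFinset _).2 h)))
  obtain ⟨T, hTn, hTc, q, x, hxI, hx0, hx⟩ := Nat.find_spec hex
  have hmin : ∀ S : Finset Q, S.card < T.card → (∀ t ∈ S, t ∈ Subgroup.center Q) → ∀ q, ∀ z ∈ I,
      z ∈ hA.supportedIn f (S : Set Q) q → z = 0 := by
    intro S hS hSc q z hzI hz
    by_contra hz0
    exact Nat.find_min hex (hTn ▸ hS) ⟨S, rfl, hSc, q, z, hzI, hz0, hz⟩
  clear hTn
  obtain ⟨g₀, hg₀⟩ := hA.exists_component_ne_zero hx0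
  have hg₀T : q⁻¹ * f g₀ ∈ T := by
    by_contra h
    exact hg₀ (hx g₀ h)
  -- translate `T` so that it contains `1`
  obtain ⟨S, hSdef⟩ : ∃ S, S = T.image ((q⁻¹ * f g₀)⁻¹ * ·) := ⟨_, rfl⟩
  have hScard : S.card = T.card :=
    hSdef ▸ Finset.card_image_of_injective _ (mul_right_injective _)
  have hSc : ∀ t ∈ S, t ∈ Subgroup.center Q := by
    intro t ht
    obtain ⟨u, hu, rfl⟩ := Finset.mem_image.1 (hSdef ▸ ht)
    exact Subgroup.mul_mem _ (inv_mem (hTc _ hg₀T)) (hTc _ hu)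
  have hS1 : 1 ∈ S := hSdef ▸ Finset.mem_image.2 ⟨_, hg₀T, inv_mul_cancel _⟩
  have hxS : x ∈ hA.supportedIn f (S : Set Q) (f g₀) := by
    intro g hg
    refine hx g fun h => hg (hSdef ▸ Finset.mem_coe.2 (Finset.mem_image.2 ⟨_, h, ?_⟩))
    group
  have hconj : ∀ U : Finset Q, (∀ t ∈ U, t ∈ Subgroup.center Q) →
      ∀ t ∈ (U : Set Q), ∀ c, c⁻¹ * t * c ∈ (U : Set Q) := by
    intro U hU t ht c
    rwa [mul_assoc, ← Subgroup.mem_center_iff.1 (hU t ht) c, inv_mul_cancel_left]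
  -- The part of `x` over the single coset `f g₀`: a non-zero element of the leading ideal to which
  -- `hf` applies.
  obtain ⟨w, hw⟩ := hA.exists_component_eq_ite (fun g => f g = f g₀) x
  have hwJ : w ∈ hA.leadingIdeal f (S : Set Q) (hconj S hSc) I := by
    rw [mem_leadingIdeal]
    intro p
    by_cases hp : p = f g₀
    · subst hp
      refine ⟨x, hxI, hxS, fun g hg => ?_⟩
      have : f g₀ = f g := inv_mul_eq_one.1 (by simpa using hg)
      rw [map_sub, hw, if_pos this.symm, sub_self]
    · refine ⟨0, I.zero_mem, zero_mem _, fun g hg => ?_⟩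
      have : p = f g := inv_mul_eq_one.1 (by simpa using hg)
      rw [sub_zero, hw, if_neg (fun h => hp (this.trans h))]
  have hw0 : w ≠ 0 := by
    rintro rfl
    have := hw g₀
    rw [map_zero, if_pos rfl] at this
    exact hg₀ this.symm
  have hJ := hf _ (f g₀) w hwJ hw0 fun g hg => by
    rw [hw, if_neg]
    exact fun h => hg (inv_mul_eq_one.2 h.symm)
  obtain ⟨y, hyI, hyS, hy1⟩ := hA.mem_leadingIdeal.1
    (show (1 : R) ∈ hA.leadingIdeal f (S : Set Q) (hconj S hSc) I from hJ ▸ trivial) 1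
  have hd : y - 1 ∈ hA.supportedIn f ((S.erase 1 : Finset Q) : Set Q) 1 := by
    intro g hg
    by_cases hg1 : f g = 1
    · rw [← neg_sub, map_neg, hy1 g (by simp [hg1]), neg_zero]
    · rw [map_sub, hyS g, hA.component_of_mem hA.one_mem, if_neg, sub_zero]
      · rintro rfl
        exact hg1 (map_one f)
      · simpa [hg1] using hg
  have hEc : ∀ t ∈ S.erase 1, t ∈ Subgroup.center Q := fun t ht => hSc t (Finset.mem_of_mem_erase ht)
  have hE := hconj _ hEc
  have hzero : ∀ q, ∀ z ∈ I, z ∈ hA.supportedIn f ((S.erase 1 : Finset Q) : Set Q) q → z = 0 :=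
    hmin _ (hScard ▸ Finset.card_erase_lt_of_mem hS1) hEc
  have hycenter : y ∈ Set.center R := by
    refine hA.mem_center_of_homogeneous (fun g r hr => ?_) (fun g h r hr s hs => ?_)
      (fun g h r hr s hs => ?_)
    -- The difference lies in `I`, and replacing `y` by `y - 1` does not change it, so minimality
    -- kills it.
    · rw [← sub_eq_zero]
      refine hzero (f g) _ (I.sub_mem (I.mul_mem_right _ _ hyI) (I.mul_mem_left _ _ hyI)) ?_
      have : y * r - r * y = (y - 1) * r - r * (y - 1) := by
        rw [sub_mul, mul_sub, one_mul, mul_one]; abel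
      rw [this]
      exact sub_mem (by simpa using hA.mul_mem_supportedIn_right hE hd hr)
        (by simpa using hA.mul_mem_supportedIn_left hd hr)
    · rw [← sub_eq_zero]
      refine hzero (f g * f h) _ (I.sub_mem (I.mul_mem_right _ _ hyI)
        (I.mul_mem_right _ _ (I.mul_mem_right _ _ hyI))) ?_
      have : y * (r * s) - y * r * s = (y - 1) * (r * s) - (y - 1) * r * s := by
        simp only [sub_mul, one_mul]; abel
      rw [this]
      exact sub_mem (by simpa using hA.mul_mem_supportedIn_right hE hd (hA.mul_mem hr hs))
        (by simpa using hA.mul_mem_supportedIn_right hE (hA.mul_mem_supportedIn_right hE hd hr) hs)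
    · rw [← sub_eq_zero]
      refine hzero (f g * f h) _ (I.sub_mem (I.mul_mem_left _ _ hyI)
        (I.mul_mem_left _ _ (I.mul_mem_left _ _ hyI))) ?_
      have : r * s * y - r * (s * y) = r * s * (y - 1) - r * (s * (y - 1)) := by
        simp only [mul_sub, mul_one]; abel
      rw [this]
      exact sub_mem (by simpa using hA.mul_mem_supportedIn_left hd (hA.mul_mem hr hs))
        (by simpa using hA.mul_mem_supportedIn_left (hA.mul_mem_supportedIn_left hd hs) hr)
  by_cases hy0 : y = 0
  · subst hy0
    have h10 : (1 : R) = 0 := by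
      have := hy1 1 (by simp)
      rwa [sub_zero, hA.component_of_mem hA.one_mem, if_pos rfl] at this
    exact (hw0 (by rw [← mul_one w, h10, mul_zero])).elim
  · exact hA.eq_top_of_homogeneous_mem hs hyI (hc hycenter) hy0

include hA in
theorem eq_top_of_ne_bot (hG : IsHypercentral G) (hs : IsGradedSimple A)
    (hc : Set.center R ⊆ (A 1 : Set R)) (I : TwoSidedIdeal R) {x : R} (hxI : x ∈ I)
    (hx0 : x ≠ 0) : I = ⊤ := by
  have key : ∀ (I : TwoSidedIdeal R) (q : G), ∀ x ∈ I, x ≠ 0 →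
      x ∈ hA.supportedIn (MonoidHom.id G) ((⊤ : Subgroup G) : Set G) q → I = ⊤ := by
    refine hG.induction (P := fun N => ∀ (I : TwoSidedIdeal R) (q : G), ∀ x ∈ I, x ≠ 0 →
      x ∈ hA.supportedIn (MonoidHom.id G) (N : Set G) q → I = ⊤) ?_ ?_ ?_
    · intro I q x hxI hx0 hx
      refine hA.eq_top_of_homogeneous_mem hs (g := q) hxI ?_ hx0
      rw [hA.ext_component (x := x) (y := hA.component q x) fun g => ?_]
      · exact hA.component_mem q x
      · rw [hA.component_of_mem (hA.component_mem q x)]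
        split_ifs with h
        · rw [h]
        · exact hx g fun h' => h (inv_mul_eq_one.1 (Subgroup.mem_bot.1 h')).symm
    · intro c hne hchain ih I q x hxI hx0 hx
      have hfin := (hA.finite_setOf_component_ne_zero x).image (fun g => q⁻¹ * g)
      -- The translated support is finite, so one member of the chain contains it.
      obtain ⟨N, hNc, hN⟩ := DirectedOn.exists_mem_subset_of_finset_subset_biUnion
        (f := fun N : Subgroup G => (N : Set G)) (s := hfin.toFinset) hne hchain.directedOn (by
          rw [hfin.coe_toFinset]
          rintro _ ⟨g, hg, rfl⟩
          have : q⁻¹ * g ∈ sSup c := by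
            by_contra h
            exact hg (hx g h)
          simpa [Subgroup.mem_sSup_of_directedOn hne hchain.directedOn] using this)
      rw [hfin.coe_toFinset] at hN
      refine ih N hNc I q x hxI hx0 fun g hg => ?_
      by_contra h
      exact hg (hN ⟨g, h, rfl⟩)
    · intro N _ ih I q x hxI hx0 hx
      refine hA.eq_top_of_supportedIn_center (f := QuotientGroup.mk' N) (q := QuotientGroup.mk' N q)
        hs hc ?_ I hxI hx0 fun g hg => hx g fun h => hg ?_
      · intro I p x hxI hx0 hx
        obtain ⟨g, hg⟩ := hA.exists_component_ne_zero hx0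
        have hp : p = QuotientGroup.mk' N g := by
          by_contra h
          exact hg (hx g fun h' => h (inv_mul_eq_one.1 h'))
        refine ih I g x hxI hx0 fun k hk => hx k fun h => hk ?_
        rw [hp] at h
        exact QuotientGroup.eq.1 (inv_mul_eq_one.1 h)
      · simpa using h
  exact key I 1 x hxI hx0 fun g hg => (hg (Subgroup.mem_top _)).elim

end IsGroupGrading
-- The center of a simple graded ring
namespace IsGroupGrading

variable {G R : Type*} [Group G] [DecidableEq G] [NonAssocRing R]
  {A : G → AddSubgroup R} (hA : IsGroupGrading A)

/-- Centrality makes the multiples of `z` a two-sided ideal. -/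
theorem exists_mul_eq_one_of_mem_center [IsSimpleRing R] {z : R} (hz : z ∈ Set.center R)
    (hz0 : z ≠ 0) : ∃ w, z * w = 1 := by
  let J : TwoSidedIdeal R := TwoSidedIdeal.mk' {r | ∃ w, z * w = r}
    ⟨0, mul_zero z⟩
    (fun {x y} ⟨a, ha⟩ ⟨b, hb⟩ => ⟨a + b, by rw [mul_add, ha, hb]⟩)
    (fun {x} ⟨a, ha⟩ => ⟨-a, by rw [mul_neg, ha]⟩)
    (fun {x y} ⟨a, ha⟩ => ⟨x * a, by
      rw [← ha, (hz.comm _).eq, hz.right_assoc, (hz.comm a).eq]⟩)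
    (fun {x y} ⟨a, ha⟩ => ⟨a * y, by rw [← ha, hz.left_assoc]⟩)
  have hJ : ∀ r, r ∈ J ↔ ∃ w, z * w = r := fun r => TwoSidedIdeal.mem_mk' _ _ _ _ _ _ r
  rcases eq_bot_or_eq_top J with h | h
  · exact (hz0 ((TwoSidedIdeal.mem_bot R).1 (h ▸ (hJ z).2 ⟨1, mul_one z⟩))).elim
  · exact (hJ 1).1 (h ▸ trivial)

include hA in
theorem finite_range_conj_of_mem_center (hfaithful : IsFaithfulGrading A)
    (hsupp : gradingSupport A = Set.univ) {z : R} (hz : z ∈ Set.center R) {g : G}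
    (hg : hA.component g z ≠ 0) : (Set.range fun a : G => a * g * a⁻¹).Finite := by
  refine (hA.finite_setOf_component_ne_zero z).subset ?_
  rintro _ ⟨a, rfl⟩
  obtain ⟨-, s, hs, hne⟩ := hfaithful g (hsupp ▸ trivial) a (hsupp ▸ trivial) _
    (hA.component_mem g z) hg
  -- Compare the components of `s * z = z * s` in degree `a * g`.
  have h1 := hA.component_mul_left hs (a * g) z
  rw [inv_mul_cancel_left, ← (hz.comm s).eq, hA.component_mul_right hs] at h1
  intro h
  rw [h, zero_mul] at h1
  exact hne h1.symm

/-- Since `g` is central, the component of `z` in degree `g` contributes to the same degree on both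
sides of each identity defining the center. -/
theorem component_mem_center {z : R} (hz : z ∈ Set.center R) {g : G}
    (hg : g ∈ Subgroup.center G) : hA.component g z ∈ Set.center R := by
  have hcomm := Subgroup.mem_center_iff.1 hg
  refine hA.mem_center_of_homogeneous (fun h r hr => ?_) (fun h k r hr s hs => ?_)
    (fun h k r hr s hs => ?_)
  · have := congrArg (hA.component (g * h)) (hz.comm r).eq
    rwa [hA.component_mul_right hr, hA.component_mul_left hr, mul_inv_cancel_right, ← hcomm,
      inv_mul_cancel_left] at this
  · have := congrArg (hA.component (g * (h * k))) (hz.left_assoc r s)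
    rwa [hA.component_mul_right (hA.mul_mem hr hs), hA.component_mul_right hs,
      hA.component_mul_right hr, mul_inv_cancel_right, ← mul_assoc g, mul_inv_cancel_right,
      mul_inv_cancel_right] at this
  · have := congrArg (hA.component (h * k * g)) (hz.right_assoc r s)
    rwa [hA.component_mul_left (hA.mul_mem hr hs), hA.component_mul_left hr,
      hA.component_mul_left hs, inv_mul_cancel_left, mul_assoc h, inv_mul_cancel_left,
      inv_mul_cancel_left] at this

include hA in
/-- A homogeneous central element of a simple ring has degree of finite order. -/
theorem isOfFinOrder_of_mem_center [IsSimpleRing R] {c : R} {g : G} (hc : c ∈ Set.center R)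
    (hcg : c ∈ A g) (hc0 : c ≠ 0) (hg1 : g ≠ 1) : IsOfFinOrder g := by
  by_contra hg
  obtain ⟨w, hw⟩ := exists_mul_eq_one_of_mem_center hc hc0
  have hinj : ∀ u, c * u = 0 → u = 0 := fun u hu => by
    have h1 := hc.right_assoc w u
    rw [← (hc.comm u).eq, hu, mul_zero, ← (hc.comm _).eq, hc.left_assoc, hw, one_mul] at h1
    exact h1
  have h1c : 1 + c ∈ Set.center R := Set.add_mem_center Set.one_mem_center hc
  have hone : (1 : R) ≠ 0 := fun h => hc0 (by rw [← mul_one c, h, mul_zero])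
  have h1c0 : 1 + c ≠ 0 := fun h => hone <| by
    have := congrArg (hA.component 1) h
    rwa [map_add, map_zero, hA.component_of_mem hA.one_mem, hA.component_of_mem hcg, if_pos rfl,
      if_neg (Ne.symm hg1), add_zero] at this
  obtain ⟨y, hy⟩ := exists_mul_eq_one_of_mem_center h1c h1c0
  -- Degree `k` of `(1 + c) * y = 1`: a recursion along the powers of `g`. If the component of `y`
  -- at `1` vanishes, non-vanishing propagates along negative powers, otherwise along non-negative
  -- ones.
  have hcomp : ∀ k, hA.component k y + c * hA.component (g⁻¹ * k) y = if k = 1 then 1 else 0 := by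
    intro k
    rw [← hA.component_of_mem hA.one_mem, ← hy, add_mul, one_mul, map_add,
      hA.component_mul_left hcg]
  have hpow := injective_pow_iff_not_isOfFinOrder.2 hg
  have hpow1 : ∀ n : ℕ, g ^ (n + 1) ≠ 1 := fun n h =>
    hg (isOfFinOrder_iff_pow_eq_one.2 ⟨n + 1, n.succ_pos, h⟩)
  have hfin := hA.finite_setOf_component_ne_zero y
  by_cases hy1 : hA.component 1 y = 0
  · have hne : ∀ n : ℕ, hA.component (g ^ (n + 1))⁻¹ y ≠ 0 := by
      intro n
      induction n with
      | zero =>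
        intro h
        have := hcomp 1
        rw [hy1, if_pos rfl, mul_one, zero_add] at this
        rw [zero_add, pow_one] at h
        rw [h, mul_zero] at this
        exact hone this.symm
      | succ n ih =>
        intro h
        have := hcomp (g ^ (n + 1))⁻¹
        rw [if_neg (by simpa using hpow1 n), ← mul_inv_rev, ← pow_succ, h, mul_zero,
          add_zero] at this
        exact ih this
    exact Set.infinite_of_injective_forall_mem (f := fun n : ℕ => (g ^ (n + 1))⁻¹)
      (fun a b hab => Nat.succ_injective (hpow (inv_injective hab))) hne hfin
  · have hne : ∀ n : ℕ, hA.component (g ^ n) y ≠ 0 := by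
      intro n
      induction n with
      | zero => rwa [pow_zero]
      | succ n ih =>
        intro h
        have := hcomp (g ^ (n + 1))
        rw [if_neg (hpow1 n), h, zero_add, pow_succ', inv_mul_cancel_left] at this
        exact ih (hinj _ this)
    exact Set.infinite_of_injective_forall_mem hpow hne hfin

include hA in
theorem center_subset_of_isSimpleRing [IsSimpleRing R] (hfaithful : IsFaithfulGrading A)
    (hsupp : gradingSupport A = Set.univ) (htf : IsTorsionFreeGroup G) (hG : IsHypercentral G) :
    Set.center R ⊆ (A 1 : Set R) := by
  intro z hz
  rw [SetLike.mem_coe, hA.ext_component (x := z) (y := hA.component 1 z) fun g => ?_]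
  · exact hA.component_mem 1 z
  · rw [hA.component_of_mem (hA.component_mem 1 z)]
    split_ifs with hg1
    · rw [hg1]
    · by_contra hg
      have hgc := mem_center_of_finite_range_conj htf hG
        (hA.finite_range_conj_of_mem_center hfaithful hsupp hz hg)
      exact htf g hg1 (hA.isOfFinOrder_of_mem_center (hA.component_mem_center hz hgc)
        (hA.component_mem g z) hg hg1)

end IsGroupGrading

theorem mainTheorem2 {G R : Type*} [Group G] [DecidableEq G] [NonAssocRing R]
    (A : G → AddSubgroup R) (hA : IsGroupGrading A)
    (hfaithful : IsFaithfulGrading A) (hsupp : gradingSupport A = Set.univ)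
    (htf : IsTorsionFreeGroup G) (hhyp : IsHypercentral G) :
    IsSimpleRing R ↔ IsGradedSimple A ∧ Set.center R ⊆ (A 1 : Set R) := by
  constructor
  · intro h
    exact ⟨fun I _ => eq_bot_or_eq_top I,
      hA.center_subset_of_isSimpleRing hfaithful hsupp htf hhyp⟩
  · rintro ⟨hs, hc⟩
    have hne : A 1 ≠ ⊥ := show (1 : G) ∈ gradingSupport A from hsupp ▸ trivial
    obtain ⟨a, ha⟩ := AddSubgroup.ne_bot_iff_exists_ne_zero.1 hne
    have : Nontrivial R := ⟨⟨a, 0, fun h => ha (Subtype.ext h)⟩⟩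
    refine ⟨⟨fun I => ?_⟩⟩
    by_cases hI : I = ⊥
    · exact Or.inl hI
    · right
      by_contra hT
      refine hI (le_bot_iff.1 fun x hx => (TwoSidedIdeal.mem_bot R).2 ?_)
      by_contra hx0
      exact hT (hA.eq_top_of_ne_bot hhyp hs hc I hx hx0)
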